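/- Let $A=V/\Lambda$ be a complex abelian variety, and let $\Theta$ be a symmetric effective divisor on $A$ inducing a principal polarization. Let $\theta$ be a theta function on $V$ with divisor $\Theta$, let $\mathrm{Km}\colon A\to\mathbb{P}H^0(A,2\Theta)^*$ be the map given by the linear system $|2\Theta|$, and let $K(A)=\mathrm{Km}(A)$ be the Kummer variety. A trisecant is a line in $\mathbb{P}H^0(A,2\Theta)^*$ that meets $K(A)$ in at least three points. A point of $\Theta$ is smooth if the differential of $\theta$ at a lift of it to $V$ is nonzero, and singular otherwise. The Gauss map $\mathcal{G}\colon\Theta^{sm}\to\mathbb{P}T_0A^*$ sends a smooth point of $\Theta$ to the class of the differential of $\theta$ at a lift of it. Let $x_1,x_2,x_3\in A$ be points whose images $\mathrm{Km}(x_1),\mathrm{Km}(x_2),\mathrm{Km}(x_3)$ are pairwise distinct and lie on a trisecant. 1. If two of the points $x_1,x_2,x_3$ lie in $\Theta$, then so does the third. 2. If all three lie in $\Theta$ and two of them are singular points of $\Theta$, then so is the third. 3. If all three lie in $\Theta$, then $\mathcal{G}(x_i)=\mathcal{G}(x_j)$ whenever $x_i$ and $x_j$ are smooth points of $\Theta$.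 -/

import Mathlib

open scoped LinearAlgebra.Projectivization

noncomputable section

namespace KummerTheta

/-! A complex abelian variety is given as a complex torus `V ⧸ Λ`, where `V` is a
finite-dimensional complex vector space and `Λ` is a full lattice in it, together with a
polarization.  Line bundles and effective divisors on the torus are given by the Appell-Humbert
theorem and by normalized theta functions on `V`. -/

variable {V : Type*} [NormedAddCommGroup V] [NormedSpace ℂ V]

/-- Sesquilinear forms on `V`, linear in the first variable. -/
abbrev SesqForm (V : Type*) [NormedAddCommGroup V] [NormedSpace ℂ V] : Type _ :=
  V →ₗ[ℂ] (V →ₗ⋆[ℂ] ℂ)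

/-- `H` is a principal polarization of the torus `V ⧸ Λ`: a positive definite Hermitian form
whose imaginary part is integer-valued and unimodular on `Λ`. -/
structure IsPrincipalPolarization (Λ : Submodule ℤ V) (H : SesqForm V) : Prop where
  hermitian : ∀ v w, H v w = starRingEnd ℂ (H w v)
  pos_def : ∀ v, v ≠ 0 → 0 < (H v v).re
  integral : ∀ l m : Λ, ∃ n : ℤ, (H l m).im = n
  unimodular : ∀ φ : Λ →ₗ[ℤ] ℤ, ∃ l : Λ, ∀ m : Λ, (H l m).im = φ m

/-- `χ` is a semicharacter of `Λ` for `H`, with values in the unit circle. -/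
structure IsSemicharacter (Λ : Submodule ℤ V) (H : SesqForm V) (χ : Λ → ℂ) : Prop where
  norm_eq_one : ∀ l, ‖χ l‖ = 1
  map_add : ∀ l m : Λ,
    χ (l + m) = χ l * χ m * Complex.exp (Real.pi * Complex.I * ((H l m).im : ℂ))

/-- The canonical factor of automorphy of the line bundle `L(H, χ)` on `V ⧸ Λ`. -/
def factor (Λ : Submodule ℤ V) (H : SesqForm V) (χ : Λ → ℂ) (l : Λ) (z : V) : ℂ :=
  χ l * Complex.exp (Real.pi * H z l + Real.pi / 2 * H l l)

/-- The space of holomorphic sections of the `n`-th power of `L(H, χ)`, as the space of holomorphic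
functions on `V` with the corresponding quasi-periodicity. -/
def sections (Λ : Submodule ℤ V) (H : SesqForm V) (χ : Λ → ℂ) (n : ℕ) :
    Submodule ℂ (V → ℂ) where
  carrier := {f | AnalyticOnNhd ℂ f Set.univ ∧
    ∀ (l : Λ) (z : V), f (z + l) = factor Λ H χ l z ^ n * f z}
  add_mem' := by
    rintro f g ⟨hf, hf'⟩ ⟨hg, hg'⟩
    refine ⟨hf.add hg, fun l z => ?_⟩
    simp only [Pi.add_apply, hf', hg']
    ring
  zero_mem' := ⟨analyticOnNhd_const, fun l z => by simp⟩
  smul_mem' := by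
    rintro c f ⟨hf, hf'⟩
    refine ⟨hf.const_smul, fun l z => ?_⟩
    simp only [Pi.smul_apply, hf', smul_eq_mul]
    ring

/-- A symmetric effective divisor `Θ` on the torus `V ⧸ Λ` which induces a principal polarization.
The line bundle `𝒪(Θ)` is `L(H, χ)`, and `Θ` is the divisor of its nonzero section `θ`. -/
structure SymmetricThetaDivisor (Λ : Submodule ℤ V) where
  /-- the first Chern class of `𝒪(Θ)` -/
  H : SesqForm V
  /-- the semicharacter of `𝒪(Θ)` -/
  χ : Λ → ℂ
  /-- the theta function with divisor `Θ` -/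
  θ : V → ℂ
  principal : IsPrincipalPolarization Λ H
  semicharacter : IsSemicharacter Λ H χ
  mem_sections : θ ∈ sections Λ H χ 1
  ne_zero : θ ≠ 0
  /-- `Θ` is symmetric: `θ(-z)` and `θ(z)` have the same divisor, that is, they differ by
  a nowhere vanishing holomorphic function -/
  symmetric : ∃ u : V → ℂ, AnalyticOnNhd ℂ u Set.univ ∧ (∀ z, u z ≠ 0) ∧
    ∀ z, θ (-z) = u z * θ z

namespace SymmetricThetaDivisor

variable {Λ : Submodule ℤ V} (D : SymmetricThetaDivisor Λ)

theorem analytic : AnalyticOnNhd ℂ D.θ Set.univ := D.mem_sections.1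

theorem theta_add (l : Λ) (z : V) : D.θ (z + l) = factor Λ D.H D.χ l z * D.θ z := by
  simpa using D.mem_sections.2 l z

theorem factor_ne_zero (l : Λ) (z : V) : factor Λ D.H D.χ l z ≠ 0 := by
  refine mul_ne_zero (fun h => ?_) (Complex.exp_ne_zero _)
  have := D.semicharacter.norm_eq_one l
  simp [h] at this

/-- The space `H⁰(A, 2Θ)`. -/
abbrev H0TwoTheta : Submodule ℂ (V → ℂ) := sections Λ D.H D.χ 2

/-- The evaluation at `z`, as an element of the dual of `H⁰(A, 2Θ)`. -/
def eval (z : V) : Module.Dual ℂ D.H0TwoTheta :=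
  (LinearMap.proj z : (V → ℂ) →ₗ[ℂ] ℂ).comp D.H0TwoTheta.subtype

theorem eval_apply (z : V) (s : D.H0TwoTheta) : D.eval z s = (s : V → ℂ) z := rfl

theorem eval_add (l : Λ) (z : V) :
    D.eval (z + l) = factor Λ D.H D.χ l z ^ 2 • D.eval z := by
  ext s
  simpa [eval_apply] using s.2.2 l z

/-- For each `y`, the function `z ↦ θ(z - y) θ(z + y)` is a section of `2Θ`. -/
theorem prod_mem (y : V) : (fun z => D.θ (z - y) * D.θ (z + y)) ∈ D.H0TwoTheta := by
  refine ⟨fun z _ => ?_, fun l z => ?_⟩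
  · have e1 : AnalyticAt ℂ (fun w => D.θ (w - y)) z :=
      (D.analytic (z - y) trivial).comp_of_eq (f := fun w => w - y) (by fun_prop) rfl
    have e2 : AnalyticAt ℂ (fun w => D.θ (w + y)) z :=
      (D.analytic (z + y) trivial).comp_of_eq (f := fun w => w + y) (by fun_prop) rfl
    exact e1.mul e2
  · have h1 : z + (l : V) - y = (z - y) + l := by abel
    have h2 : z + (l : V) + y = (z + y) + l := by abel
    have h3 : factor Λ D.H D.χ l (z - y) * factor Λ D.H D.χ l (z + y)
        = factor Λ D.H D.χ l z ^ 2 := by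
      simp only [factor, map_sub, map_add, LinearMap.sub_apply, LinearMap.add_apply]
      rw [mul_mul_mul_comm, ← Complex.exp_add, mul_pow, ← Complex.exp_nat_mul]
      rw [sq]
      congr 2
      push_cast
      ring
    simp only [h1, h2, D.theta_add, ← h3]
    ring

/-- The linear system `|2Θ|` has no base points. -/
theorem eval_ne_zero (z : V) : D.eval z ≠ 0 := by
  intro h
  have key : ∀ y, D.θ (z - y) * D.θ (z + y) = 0 := fun y => by
    have := congrArg (fun φ => φ ⟨_, D.prod_mem y⟩) h
    simpa [eval_apply] using this
  have h2 : AnalyticOnNhd ℂ (fun y => D.θ (z + y)) Set.univ := fun y _ =>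
    (D.analytic (z + y) trivial).comp_of_eq (f := fun w => z + w) (by fun_prop) rfl
  obtain ⟨w, hw⟩ := Function.ne_iff.1 D.ne_zero
  have hc : ContinuousAt (fun y => D.θ (z - y)) (z - w) :=
    ((D.analytic (z - (z - w)) trivial).comp_of_eq (f := fun w => z - w)
      (by fun_prop) rfl).continuousAt
  have hev := hc.eventually_ne (y := 0) (by simpa using hw)
  have h0 := h2.eqOn_zero_of_preconnected_of_eventuallyEq_zero isPreconnected_univ
    (Set.mem_univ (z - w)) (hev.mono fun y hy => (mul_eq_zero.1 (key y)).resolve_left hy)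
  exact D.ne_zero (funext fun v => by simpa using h0 (Set.mem_univ (v - z)))

/-- The Kummer map `Km : A → ℙ H⁰(A, 2Θ)^*`. -/
def Km : V ⧸ Λ → ℙ ℂ (Module.Dual ℂ D.H0TwoTheta) :=
  Quotient.lift (fun z => Projectivization.mk ℂ (D.eval z) (D.eval_ne_zero z)) <| by
    intro z w hzw
    have hmem : w - z ∈ Λ := by
      have := (Submodule.quotientRel_def Λ).1 hzw
      simpa using Λ.neg_mem this
    have hw : w = z + ((⟨w - z, hmem⟩ : Λ) : V) := by simp
    refine ((Projectivization.mk_eq_mk_iff' ℂ _ _ _ _).2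
      ⟨factor Λ D.H D.χ ⟨w - z, hmem⟩ z ^ 2, ?_⟩).symm
    rw [← D.eval_add, ← hw]

theorem Km_mk (z : V) :
    D.Km (Submodule.Quotient.mk z) = Projectivization.mk ℂ (D.eval z) (D.eval_ne_zero z) := rfl

/-- The Kummer variety `K(A)`. -/
def kummerVariety : Set (ℙ ℂ (Module.Dual ℂ D.H0TwoTheta)) := Set.range D.Km

/-- The points of the projective linear subspace `ℙ(W)`. -/
def pointsOf (W : Submodule ℂ (Module.Dual ℂ D.H0TwoTheta)) :
    Set (ℙ ℂ (Module.Dual ℂ D.H0TwoTheta)) := {p | p.submodule ≤ W}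

/-- `ℙ(W)` is a trisecant of the Kummer variety: a line that meets it in at least three points. -/
def IsTrisecant (W : Submodule ℂ (Module.Dual ℂ D.H0TwoTheta)) : Prop :=
  Module.finrank ℂ W = 2 ∧ 3 ≤ (D.kummerVariety ∩ D.pointsOf W).encard

/-- The support of the divisor `Θ` in `A`. -/
def support : Set (V ⧸ Λ) := {a | ∃ z : V, Submodule.Quotient.mk z = a ∧ D.θ z = 0}

/-- The smooth locus of `Θ`. -/
def smoothLocus : Set (V ⧸ Λ) :=
  {a | ∃ z : V, Submodule.Quotient.mk z = a ∧ D.θ z = 0 ∧ fderiv ℂ D.θ z ≠ 0}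

/-- The singular locus of `Θ`. -/
def singularLocus : Set (V ⧸ Λ) := D.support \ D.smoothLocus

theorem exists_of_mk_eq {V : Type*} [AddCommGroup V] {Λ : Submodule ℤ V} {z w : V}
    (h : (Submodule.Quotient.mk z : V ⧸ Λ) = Submodule.Quotient.mk w) :
    ∃ l : Λ, w = z + l :=
  ⟨⟨w - z, (Submodule.Quotient.eq Λ).1 h.symm⟩, by simp⟩

theorem mk_mem_support {z : V} : Submodule.Quotient.mk z ∈ D.support ↔ D.θ z = 0 := by
  refine ⟨?_, fun h => ⟨z, rfl, h⟩⟩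
  rintro ⟨w, hw, h0⟩
  obtain ⟨l, rfl⟩ := exists_of_mk_eq hw
  rw [D.theta_add, h0, mul_zero]

/-- At a zero of `θ`, the differentials of `θ` at two lifts of a point are proportional. -/
theorem fderiv_add (l : Λ) {z : V} (hz : D.θ z = 0) :
    fderiv ℂ D.θ (z + l) = factor Λ D.H D.χ l z • fderiv ℂ D.θ z := by
  have hd : DifferentiableAt ℂ D.θ z := (D.analytic z trivial).differentiableAt
  have hd' : DifferentiableAt ℂ D.θ (z + l) := (D.analytic (z + l) trivial).differentiableAt
  -- the dependence of the factor on its second argument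
  have hf : ∀ w v : V, factor Λ D.H D.χ l (w + v)
      = factor Λ D.H D.χ l w * Complex.exp (Real.pi * D.H v l) := fun w v => by
    simp only [factor, map_add, LinearMap.add_apply]
    rw [mul_assoc, ← Complex.exp_add]
    congr 2
    ring
  ext v
  have e1 : HasDerivAt (fun t : ℂ => z + t • v) v 0 := by
    simpa using ((hasDerivAt_id (0 : ℂ)).smul_const v).const_add z
  have e2 : HasDerivAt (fun t : ℂ => D.θ (z + t • v)) (fderiv ℂ D.θ z v) 0 := by
    have := hd.hasFDerivAt
    rw [show z = z + (0 : ℂ) • v by simp] at this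
    simpa [Function.comp_def] using this.comp_hasDerivAt (0 : ℂ) e1
  have e3 : HasDerivAt (fun t : ℂ => D.θ (z + t • v + l)) (fderiv ℂ D.θ (z + l) v) 0 := by
    have := hd'.hasFDerivAt
    rw [show z + (l : V) = z + (0 : ℂ) • v + l by simp] at this
    simpa [Function.comp_def] using this.comp_hasDerivAt (0 : ℂ) (e1.add_const (l : V))
  have e4 : HasDerivAt (fun t : ℂ => factor Λ D.H D.χ l z * Complex.exp (Real.pi * (t * D.H v l)))
      (factor Λ D.H D.χ l z * (Real.pi * D.H v l)) 0 := by
    have := (((hasDerivAt_id (0 : ℂ)).mul_const (D.H v l)).const_mul (Real.pi : ℂ)).cexp.const_mul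
      (factor Λ D.H D.χ l z)
    simpa using this
  have e5 := e4.mul e2
  have e6 : (fun t : ℂ => D.θ (z + t • v + l)) = fun t : ℂ =>
      factor Λ D.H D.χ l z * Complex.exp (Real.pi * (t * D.H v l)) * D.θ (z + t • v) := by
    funext t
    rw [D.theta_add, hf]
    simp
  rw [e6] at e3
  have := e3.unique e5
  simpa [hz] using this

theorem mk_mem_smoothLocus {z : V} :
    Submodule.Quotient.mk z ∈ D.smoothLocus ↔ D.θ z = 0 ∧ fderiv ℂ D.θ z ≠ 0 := by
  refine ⟨?_, fun h => ⟨z, rfl, h⟩⟩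
  rintro ⟨w, hw, h0, h1⟩
  obtain ⟨l, rfl⟩ := exists_of_mk_eq hw
  rw [D.theta_add, h0, mul_zero, D.fderiv_add l h0]
  exact ⟨rfl, smul_ne_zero (D.factor_ne_zero l w) h1⟩

/-- The Gauss map `𝒢 : Θ^sm → ℙ T₀A^*`, which sends a smooth point of `Θ` to the class of the
differential of `θ` at a lift of it. -/
def gaussMap (a : D.smoothLocus) : ℙ ℂ (V →L[ℂ] ℂ) :=
  Projectivization.mk ℂ (fderiv ℂ D.θ a.2.choose) a.2.choose_spec.2.2

/-- The Gauss map can be computed at any lift. -/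
theorem gaussMap_mk (z : V) (h : Submodule.Quotient.mk z ∈ D.smoothLocus) :
    D.gaussMap ⟨Submodule.Quotient.mk z, h⟩ =
      Projectivization.mk ℂ (fderiv ℂ D.θ z) (D.mk_mem_smoothLocus.1 h).2 := by
  obtain ⟨l, hl⟩ := exists_of_mk_eq h.choose_spec.1.symm
  refine (Projectivization.mk_eq_mk_iff' ℂ _ _ _ _).2 ⟨factor Λ D.H D.χ l z, ?_⟩
  rw [← D.fderiv_add l (D.mk_mem_smoothLocus.1 h).1, ← hl]

end SymmetricThetaDivisor

end KummerTheta

end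

/-! A linear relation `∑ cᵢ • eval zᵢ = 0` between lifts of the three points, applied to the sections
`z ↦ θ(z - y) θ(z + y)` of `2Θ`, gives `∑ cᵢ θ(zᵢ - y) θ(zᵢ + y) = 0` for every `y ∈ V`. Because the
three points of the Kummer variety are distinct, every `cᵢ` is nonzero
(`exists_relation_of_collinear`).

At `y = 0` the relation reads `∑ cᵢ θ(zᵢ)² = 0`, so two zeros of `θ` force the third. If `θ` vanishes
at all `zᵢ`, then the leading term of the relation at `y = 0` is quadratic, and it reads
`∑ cᵢ ℓᵢ² = 0` for the differentials `ℓᵢ` of `θ` at `zᵢ` (`sum_mul_fderiv_sq_eq_zero`). Hence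
`ℓᵢ = ℓⱼ = 0` forces `ℓₖ = 0`. Moreover `ℓᵢ` and `ℓⱼ` are proportional, because for independent `ℓᵢ` and
`ℓⱼ` the form `cᵢ ℓᵢ² + cⱼ ℓⱼ²` has rank two and is not a multiple of a square
(`exists_smul_eq_of_sum_sq_eq_zero`). -/

open Filter Topology

namespace KummerTheta

theorem sum_fin_three_of_ne {M : Type*} [AddCommMonoid M] (f : Fin 3 → M) {i j k : Fin 3}
    (hij : i ≠ j) (hik : i ≠ k) (hjk : j ≠ k) : ∑ m, f m = f i + f j + f k := by
  have : ∀ i j k : Fin 3, i ≠ j → i ≠ k → j ≠ k → (Finset.univ : Finset (Fin 3)) = {i, j, k} := by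
    decide
  rw [this i j k hij hik hjk, Finset.sum_insert (by simp [hij, hik]), Finset.sum_pair hjk, add_assoc]

/-- Three collinear and pairwise distinct points of a projective space satisfy a linear relation
all of whose coefficients are nonzero. -/
theorem exists_relation_of_collinear {K E : Type*} [Field K] [AddCommGroup E] [Module K E]
    {W : Submodule K E} (hW : Module.finrank K W = 2) (v : Fin 3 → E) (hv : ∀ i, v i ≠ 0)
    (hvW : ∀ i, v i ∈ W) (hinj : Function.Injective fun i => Projectivization.mk K (v i) (hv i)) :
    ∃ c : Fin 3 → K, (∀ i, c i ≠ 0) ∧ ∑ i, c i • v i = 0 := by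
  have : FiniteDimensional K W := Module.finite_of_finrank_pos (by omega)
  have hdep : ¬ LinearIndependent K fun i => (⟨v i, hvW i⟩ : W) := fun h => by
    have := h.fintype_card_le_finrank
    rw [hW, Fintype.card_fin] at this
    omega
  obtain ⟨c, hc, i, hi⟩ := Fintype.not_linearIndependent_iff.1 hdep
  have hsum : ∑ i, c i • v i = 0 := by simpa using congrArg W.subtype hc
  refine ⟨c, fun k hk => ?_, hsum⟩
  have hik : i ≠ k := fun h => hi (h ▸ hk)
  obtain ⟨j, hij, hjk⟩ : ∃ j : Fin 3, i ≠ j ∧ j ≠ k := by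
    clear hi hk
    revert i k
    decide
  rw [sum_fin_three_of_ne _ hij hik hjk, hk, zero_smul, add_zero] at hsum
  refine hij (hinj ((Projectivization.mk_eq_mk_iff' K _ _ _ _).2 ⟨-(c i)⁻¹ * c j, ?_⟩))
  rw [mul_smul, ← neg_eq_of_add_eq_zero_right hsum, smul_neg, neg_smul, neg_neg, inv_smul_smul₀ hi]

/-- If a combination of the squares of three linear forms vanishes and its coefficients are nonzero,
then any two of the forms are proportional. -/
theorem exists_smul_eq_of_sum_sq_eq_zero {K E : Type*} [Field K] [NeZero (2 : K)]
    [AddCommGroup E] [Module K E] (a b e : E →ₗ[K] K) {p q r : K} (hp : p ≠ 0) (hq : q ≠ 0)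
    (hr : r ≠ 0) (h : ∀ v, p * a v ^ 2 + q * b v ^ 2 + r * e v ^ 2 = 0) (hb : b ≠ 0) :
    ∃ s : K, s • b = a := by
  have h2 : (2 : K) ≠ 0 := NeZero.ne 2
  obtain ⟨u, hu⟩ : ∃ u, b u ≠ 0 := by
    by_contra! hcon
    exact hb (LinearMap.ext hcon)
  have hker : ∀ v, b v = 0 → a v = 0 := by
    intro v hbv
    by_contra hav
    -- `w` and `v` are, up to scaling, dual to `b` and `a`; `p a² + q b²` is then diagonal in them,
    -- while `r e²` has a nonzero mixed term
    obtain ⟨w, haw, hbw⟩ : ∃ w, a w = 0 ∧ b w ≠ 0 :=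
      ⟨u - (a u / a v) • v, by simp [hav], by simpa [hbv] using hu⟩
    have hv := h v
    have hw := h w
    have hvw := h (v + w)
    simp only [map_add, hbv, haw] at hv hw hvw
    have hev : e v ≠ 0 := fun h0 => by simp [h0, hp, hav] at hv
    have hew : e w ≠ 0 := fun h0 => by simp [h0, hq, hbw] at hw
    have : 2 * (r * (e v * e w)) = 0 := by linear_combination hvw - hv - hw
    simp [h2, hr, hev, hew] at this
  refine ⟨a u / b u, LinearMap.ext fun v => ?_⟩
  have := hker (v - (b v / b u) • u) (by simp [hu])
  simp only [map_sub, map_smul, smul_eq_mul, sub_eq_zero] at this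
  rw [LinearMap.smul_apply, smul_eq_mul, this]
  ring

variable {V : Type*} [NormedAddCommGroup V] [NormedSpace ℂ V]

/-- The leading term at `y = 0` of `f (z - y) * f (z + y)`, where `f z = 0`, is minus the square of
the differential of `f` at `z`. -/
theorem tendsto_prod_div_sq {f : V → ℂ} {z : V} (hf : DifferentiableAt ℂ f z) (hz : f z = 0)
    (v : V) :
    Tendsto (fun t : ℂ => f (z - t • v) * f (z + t • v) / t ^ 2) (𝓝[≠] 0)
      (𝓝 (-(fderiv ℂ f z v) ^ 2)) := by
  have key : ∀ w : V, Tendsto (fun t : ℂ => t⁻¹ * f (z + t • w)) (𝓝[≠] 0)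
      (𝓝 (fderiv ℂ f z w)) := fun w => by
    have e : HasLineDerivAt ℂ f (fderiv ℂ f z w) z w := hf.hasFDerivAt.hasLineDerivAt w
    simpa [hz] using e.tendsto_slope_zero
  convert (key (-v)).mul (key v) using 2 with t
  · rw [smul_neg, ← sub_eq_add_neg, div_eq_mul_inv, ← inv_pow]
    ring
  · rw [map_neg]
    ring

namespace SymmetricThetaDivisor

variable {Λ : Submodule ℤ V} (D : SymmetricThetaDivisor Λ)

theorem sum_mul_theta_eq_zero {ι : Type*} [Fintype ι] {c : ι → ℂ} {z : ι → V}
    (h : ∑ i, c i • D.eval (z i) = 0) (y : V) :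
    ∑ i, c i * (D.θ (z i - y) * D.θ (z i + y)) = 0 := by
  simpa [eval_apply] using congrArg (fun φ => φ ⟨_, D.prod_mem y⟩) h

theorem sum_mul_theta_sq_eq_zero {ι : Type*} [Fintype ι] {c : ι → ℂ} {z : ι → V}
    (h : ∑ i, c i • D.eval (z i) = 0) : ∑ i, c i * D.θ (z i) ^ 2 = 0 := by
  simpa [sq] using D.sum_mul_theta_eq_zero h 0

theorem sum_mul_fderiv_sq_eq_zero {ι : Type*} [Fintype ι] {c : ι → ℂ} {z : ι → V}
    (h : ∑ i, c i • D.eval (z i) = 0) (hz : ∀ i, D.θ (z i) = 0) (v : V) :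
    ∑ i, c i * fderiv ℂ D.θ (z i) v ^ 2 = 0 := by
  have hlim := tendsto_finsetSum Finset.univ fun i _ =>
    (tendsto_prod_div_sq (D.analytic (z i) trivial).differentiableAt (hz i) v).const_mul (c i)
  have hzero : ∀ t : ℂ,
      ∑ i, c i * (D.θ (z i - t • v) * D.θ (z i + t • v) / t ^ 2) = 0 := fun t => by
    simp_rw [← mul_div_assoc]
    rw [← Finset.sum_div, D.sum_mul_theta_eq_zero h, zero_div]
  simp_rw [hzero] at hlim
  simpa using tendsto_nhds_unique hlim tendsto_const_nhds

theorem mk_mem_singularLocus {z : V} :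
    Submodule.Quotient.mk z ∈ D.singularLocus ↔ D.θ z = 0 ∧ fderiv ℂ D.θ z = 0 := by
  rw [singularLocus, Set.mem_sdiff, mk_mem_support, mk_mem_smoothLocus]
  tauto

end SymmetricThetaDivisor

end KummerTheta

theorem corollaryc1 {V : Type*} [NormedAddCommGroup V] [NormedSpace ℂ V] [FiniteDimensional ℂ V]
    (Λ : Submodule ℤ V) [DiscreteTopology Λ] [IsZLattice ℝ Λ]
    (D : KummerTheta.SymmetricThetaDivisor Λ)
    (W : Submodule ℂ (Module.Dual ℂ D.H0TwoTheta)) (hW : D.IsTrisecant W)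
    (x : Fin 3 → V ⧸ Λ) (hdistinct : Function.Injective fun i => D.Km (x i))
    (hx : ∀ i, D.Km (x i) ∈ D.pointsOf W) :
    (∀ i j k, i ≠ j → x i ∈ D.support → x j ∈ D.support → x k ∈ D.support) ∧
    ((∀ i, x i ∈ D.support) →
      ∀ i j k, i ≠ j → x i ∈ D.singularLocus → x j ∈ D.singularLocus → x k ∈ D.singularLocus) ∧
    ((∀ i, x i ∈ D.support) →
      ∀ i j (hi : x i ∈ D.smoothLocus) (hj : x j ∈ D.smoothLocus),
        D.gaussMap ⟨x i, hi⟩ = D.gaussMap ⟨x j, hj⟩) := by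
  choose z hz using fun i => Submodule.Quotient.mk_surjective Λ (x i)
  obtain rfl : (fun i => Submodule.Quotient.mk (z i)) = x := funext hz
  obtain ⟨c, hc, hrel⟩ := KummerTheta.exists_relation_of_collinear hW.1 (fun i => D.eval (z i))
    (fun i => D.eval_ne_zero (z i))
    (fun i => hx i (by
      rw [D.Km_mk, Projectivization.submodule_mk]
      exact Submodule.mem_span_singleton_self _))
    hdistinct
  simp only [D.mk_mem_support, D.mk_mem_singularLocus]
  refine ⟨fun i j k hij hi hj => ?_, fun h0 i j k hij hi hj => ⟨h0 k, ?_⟩,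
    fun h0 i j hi hj => ?_⟩
  · rcases eq_or_ne i k with rfl | hik
    · exact hi
    rcases eq_or_ne j k with rfl | hjk
    · exact hj
    have h := D.sum_mul_theta_sq_eq_zero hrel
    rw [KummerTheta.sum_fin_three_of_ne _ hij hik hjk] at h
    simpa [hi, hj, hc k] using h
  · rcases eq_or_ne i k with rfl | hik
    · exact hi.2
    rcases eq_or_ne j k with rfl | hjk
    · exact hj.2
    ext v
    have h := D.sum_mul_fderiv_sq_eq_zero hrel h0 v
    rw [KummerTheta.sum_fin_three_of_ne _ hij hik hjk] at h
    simpa [hi.2, hj.2, hc k] using h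
  · rcases eq_or_ne i j with rfl | hij
    · rfl
    obtain ⟨k, hik, hjk⟩ : ∃ k : Fin 3, i ≠ k ∧ j ≠ k := by
      clear hi hj
      revert i j
      decide
    rw [D.gaussMap_mk, D.gaussMap_mk]
    have hb : (fderiv ℂ D.θ (z j) : V →ₗ[ℂ] ℂ) ≠ 0 := fun h =>
      (D.mk_mem_smoothLocus.1 hj).2 (ContinuousLinearMap.coe_injective h)
    obtain ⟨s, hs⟩ := KummerTheta.exists_smul_eq_of_sum_sq_eq_zero
      (fderiv ℂ D.θ (z i) : V →ₗ[ℂ] ℂ) (fderiv ℂ D.θ (z j)) (fderiv ℂ D.θ (z k))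
      (hc i) (hc j) (hc k) (fun v => by
        have h := D.sum_mul_fderiv_sq_eq_zero hrel h0 v
        rwa [KummerTheta.sum_fin_three_of_ne _ hij hik hjk] at h) hb
    exact (Projectivization.mk_eq_mk_iff' ℂ _ _ _ _).2
      ⟨s, ContinuousLinearMap.coe_injective hs⟩
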